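/- Let $\mu>0$ and put $\ln_\mu(x)=\ln(1+\mu+x)$ for $x\in[0,1]$. For $n\ge 1$, $f\in C([0,1])$ and $x\in[0,1]$ let $$a_n(x)=\frac{\ln(1+\mu+\frac{x}{n})-\ln(1+\mu)}{\ln(1+\mu+\frac1n)-\ln(1+\mu)},\qquad \mathscr L_n(f,x)=\ln_\mu(x)\sum_{k=0}^n f\!\left(\tfrac kn\right)\frac{1}{\ln_\mu(k/n)}\binom nk a_n(x)^k(1-a_n(x))^{n-k},$$ and write $f_\mu=f/\ln_\mu$. Let $f\in C([0,1])$ be fixed. Then $$|\mathscr L_n(f,x)-f(x)|=o(n^{-1})\quad (n\to\infty)\qquad\text{for every } 0<x<1$$ (pointwise in $x$) if and only if $f$ is a classical solution of $$f_\mu'(x)+(1+\mu)f_\mu''(x)=0,\qquad 0<x<1,$$ that is, $f$ is twice continuously differentiable on $(0,1)$ and satisfies the equation at every point of $(0,1)$. Moreover, $f$ is such a classical solution if and only if there are $A,B\in\mathbb R$ with $$f(x)=A\,\ln_\mu(x)+B\,\ln_\mu(x)\,e^{-x/(1+\mu)}\qquad\text{for all } x\in[0,1].$$ -/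

import Mathlib

open Filter Set Asymptotics

noncomputable section

namespace LogBernstein

/-- The function `ln_μ(x) = ln(1 + μ + x)`. -/
def lnMu (μ x : ℝ) : ℝ := Real.log (1 + μ + x)

/-- The quotient `f_μ = f / ln_μ`. -/
def quot (μ : ℝ) (f : ℝ → ℝ) (x : ℝ) : ℝ := f x / lnMu μ x

/-- The binomial weight `p_{n,k}(x) = C(n,k) x^k (1-x)^(n-k)`. -/
def weight (n k : ℕ) (x : ℝ) : ℝ := (bernsteinPolynomial ℝ n k).eval x

/-- The weight written out explicitly. -/
theorem weight_eq (n k : ℕ) (x : ℝ) :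
    weight n k x = (n.choose k : ℝ) * x ^ k * (1 - x) ^ (n - k) := by
  simp [weight, bernsteinPolynomial]

/-- The function
`a_n(x) = (ln(1 + μ + x/n) - ln(1 + μ)) / (ln(1 + μ + 1/n) - ln(1 + μ))`, for `n ≥ 1`. -/
def node (μ : ℝ) (n : ℕ) (x : ℝ) : ℝ :=
  (Real.log (1 + μ + x / n) - Real.log (1 + μ)) /
    (Real.log (1 + μ + 1 / n) - Real.log (1 + μ))

/-- The Bernstein-type logarithmic operator
`L_n(f,x) = ln_μ(x) ∑_{k=0}^n f(k/n) (1 / ln_μ(k/n)) p_{n,k}(a_n(x))`, for `n ≥ 1`. -/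
def logOp (μ : ℝ) (n : ℕ) (f : ℝ → ℝ) (x : ℝ) : ℝ :=
  lnMu μ x * ∑ k ∈ Finset.range (n + 1),
    f ((k : ℝ) / n) * (1 / lnMu μ ((k : ℝ) / n)) * weight n k (node μ n x)

/-- `f` is a classical solution of `f_μ' + (1 + μ) f_μ'' = 0` on `(0,1)`: it is twice continuously
differentiable there and satisfies the equation at every point. -/
def IsClassicalSolution (μ : ℝ) (f : ℝ → ℝ) : Prop :=
  ContDiffOn ℝ 2 f (Ioo 0 1) ∧
    ∀ x ∈ Ioo (0 : ℝ) 1, deriv (quot μ f) x + (1 + μ) * deriv (deriv (quot μ f)) x = 0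

end LogBernstein

end

open scoped Topology

namespace LogBernstein

/-! Dividing by `lnMu` turns the error into that of Bernstein operators at the nodes a_n(x), with g
= f/ln_μ. No Voronovskaya formula is used, so g need only be continuous. Constants are reproduced
exactly, and e^{-y/(1+μ)} has error O(n⁻²), since its Bernstein image is explicit and log(1+s)
agrees with 1 - e^{-s} to second order (`fastAt_exp`). Conversely, subtract from g the element of
this two-dimensional span with the same endpoint values. The difference has error o(1/n) and
vanishes at 0 and 1; as the nodes exceed x by order 1/n, a maximum principle forces it to be zero
(`nonpos_of_fastAt`). The span is also the solution space of the differential equation. -/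

/-- The Bernstein operator `B_n(g, t) = ∑_{k=0}^n g(k/n) p_{n,k}(t)`. -/
noncomputable def bernstein (n : ℕ) (g : ℝ → ℝ) (t : ℝ) : ℝ :=
  ∑ k ∈ Finset.range (n + 1), g ((k : ℝ) / n) * weight n k t

theorem weight_nonneg (n k : ℕ) {t : ℝ} (ht : t ∈ Icc (0 : ℝ) 1) : 0 ≤ weight n k t := by
  rw [weight_eq]
  have h0 := ht.1
  have h1 := sub_nonneg.2 ht.2
  positivity

theorem sum_weight (n : ℕ) (t : ℝ) : ∑ k ∈ Finset.range (n + 1), weight n k t = 1 := by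
  simpa [weight, Polynomial.eval_finsetSum] using
    congrArg (Polynomial.eval t) (bernsteinPolynomial.sum ℝ n)

theorem bernstein_add (n : ℕ) (g h : ℝ → ℝ) (t : ℝ) :
    bernstein n (fun y => g y + h y) t = bernstein n g t + bernstein n h t := by
  simp [bernstein, add_mul, Finset.sum_add_distrib]

theorem bernstein_const_mul (n : ℕ) (a : ℝ) (g : ℝ → ℝ) (t : ℝ) :
    bernstein n (fun y => a * g y) t = a * bernstein n g t := by
  simp [bernstein, Finset.mul_sum, mul_assoc]

theorem bernstein_const (n : ℕ) (a : ℝ) (t : ℝ) : bernstein n (fun _ => a) t = a := by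
  simp [bernstein, ← Finset.mul_sum, sum_weight]

theorem bernstein_id {n : ℕ} (hn : n ≠ 0) (t : ℝ) : bernstein n (fun y => y) t = t := by
  have h := congrArg (Polynomial.eval t) (bernsteinPolynomial.sum_smul ℝ n)
  simp only [Polynomial.eval_finsetSum, nsmul_eq_mul, Polynomial.eval_mul,
    Polynomial.eval_natCast, Polynomial.eval_X] at h
  have hn' : (n : ℝ) ≠ 0 := Nat.cast_ne_zero.2 hn
  have : bernstein n (fun y => y) t = (∑ k ∈ Finset.range (n + 1), (k : ℝ) * weight n k t) / n := by
    rw [bernstein, Finset.sum_div]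
    exact Finset.sum_congr rfl fun k _ => by ring
  rw [this]
  simp only [weight]
  rw [h]
  field_simp

theorem bernstein_exp {n : ℕ} (hn : n ≠ 0) (b t : ℝ) :
    bernstein n (fun y => Real.exp (b * y)) t = (1 - t * (1 - Real.exp (b / n))) ^ n := by
  have hn' : (n : ℝ) ≠ 0 := Nat.cast_ne_zero.2 hn
  have : 1 - t * (1 - Real.exp (b / n)) = t * Real.exp (b / n) + (1 - t) := by ring
  rw [this, add_pow, bernstein]
  refine Finset.sum_congr rfl fun k _ => ?_
  rw [weight_eq, mul_pow, ← Real.exp_nat_mul]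
  have : b * ((k : ℝ) / n) = k * (b / n) := by ring
  rw [this]
  ring

theorem div_mem_Icc {n k : ℕ} (hk : k ∈ Finset.range (n + 1)) : (k : ℝ) / n ∈ Icc (0 : ℝ) 1 := by
  have : (k : ℝ) ≤ n := by exact_mod_cast Nat.lt_succ_iff.1 (Finset.mem_range.1 hk)
  exact ⟨by positivity, div_le_one_of_le₀ this (by positivity)⟩

theorem bernstein_congr {n : ℕ} {g h : ℝ → ℝ} (hgh : EqOn g h (Icc 0 1)) (t : ℝ) :
    bernstein n g t = bernstein n h t :=
  Finset.sum_congr rfl fun k hk => by rw [hgh (div_mem_Icc hk)]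

theorem bernstein_le {n : ℕ} {g : ℝ → ℝ} {M t : ℝ} (ht : t ∈ Icc (0 : ℝ) 1)
    (hg : ∀ y ∈ Icc (0 : ℝ) 1, g y ≤ M) : bernstein n g t ≤ M := by
  rw [← bernstein_const n M t]
  exact Finset.sum_le_sum fun k hk =>
    mul_le_mul_of_nonneg_right (hg _ (div_mem_Icc hk)) (weight_nonneg n k ht)

theorem logOp_eq (μ : ℝ) (n : ℕ) (f : ℝ → ℝ) (x : ℝ) :
    logOp μ n f x = lnMu μ x * bernstein n (quot μ f) (node μ n x) := by
  simp [logOp, bernstein, quot, div_eq_mul_inv]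

theorem lnMu_pos {μ x : ℝ} (hμ : 0 < μ) (hx : 0 ≤ x) : 0 < lnMu μ x :=
  Real.log_pos (by linarith)

/-! ### Expansion of the nodes -/

theorem node_eq {μ : ℝ} (hμ : 0 < μ) {n : ℕ} (hn : n ≠ 0) {x : ℝ} (hx : 0 ≤ x) :
    node μ n x =
      Real.log (1 + x * ((1 + μ) * n)⁻¹) / Real.log (1 + ((1 + μ) * n)⁻¹) := by
  have hn' : (0 : ℝ) < n := Nat.cast_pos.2 (Nat.pos_of_ne_zero hn)
  have key : ∀ y : ℝ, 0 ≤ y →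
      Real.log (1 + μ + y / n) - Real.log (1 + μ) = Real.log (1 + y * ((1 + μ) * n)⁻¹) := by
    intro y hy
    rw [← Real.log_div (by positivity) (by positivity)]
    congr 1
    field_simp
  rw [node, key x hx, key 1 zero_le_one, one_mul]

theorem node_mem {μ : ℝ} (hμ : 0 < μ) {n : ℕ} (hn : n ≠ 0) {x : ℝ} (hx : x ∈ Icc (0 : ℝ) 1) :
    node μ n x ∈ Icc (0 : ℝ) 1 := by
  rw [node_eq hμ hn hx.1]
  have hn' : (0 : ℝ) < n := Nat.cast_pos.2 (Nat.pos_of_ne_zero hn)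
  have hs : 0 < ((1 + μ) * (n : ℝ))⁻¹ := by positivity
  have hxs : 0 ≤ x * ((1 + μ) * (n : ℝ))⁻¹ := mul_nonneg hx.1 hs.le
  have h1 : 0 ≤ Real.log (1 + ((1 + μ) * (n : ℝ))⁻¹) := Real.log_nonneg (by linarith)
  refine ⟨div_nonneg (Real.log_nonneg (by linarith)) h1, div_le_one_of_le₀ ?_ h1⟩
  exact Real.log_le_log (by linarith) (by nlinarith [hx.2])

theorem abs_log_one_add_sub_le {s : ℝ} (hs : 0 ≤ s) (hs' : s ≤ 1 / 2) :
    |Real.log (1 + s) - (s - s ^ 2 / 2)| ≤ 2 * s ^ 3 := by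
  have h := Real.abs_log_sub_add_sum_range_le (x := -s) (by rw [abs_neg, abs_of_nonneg hs]; linarith) 2
  simp only [Finset.sum_range_succ, Finset.sum_range_zero, abs_neg, abs_of_nonneg hs] at h
  have e : Real.log (1 + s) - (s - s ^ 2 / 2) =
      0 + (-s) ^ (0 + 1) / ((0 : ℕ) + 1) + (-s) ^ (1 + 1) / ((1 : ℕ) + 1) + Real.log (1 - -s) := by
    norm_num
    ring
  rw [e]
  refine h.trans ?_
  rw [div_le_iff₀ (by linarith)]
  have : 0 ≤ s ^ 3 := by positivity
  norm_num
  nlinarith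

theorem abs_one_sub_exp_neg_sub_le {s : ℝ} (hs : 0 ≤ s) (hs' : s ≤ 1 / 2) :
    |(1 - Real.exp (-s)) - (s - s ^ 2 / 2)| ≤ s ^ 3 := by
  have h := Real.exp_bound (x := -s) (n := 3) (by rw [abs_neg, abs_of_nonneg hs]; linarith)
    (by norm_num)
  simp only [Finset.sum_range_succ, Finset.sum_range_zero, abs_neg, abs_of_nonneg hs] at h
  rw [← abs_neg] at h
  norm_num [Nat.factorial] at h
  have : 0 ≤ s ^ 3 := by positivity
  have e : (1 - Real.exp (-s)) - (s - s ^ 2 / 2) = 1 + -s + s ^ 2 / 2 - Real.exp (-s) := by ring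
  rw [e]
  linarith

theorem abs_log_sub_exp_le {s : ℝ} (hs : 0 ≤ s) (hs' : s ≤ 1 / 2) :
    |Real.log (1 + s) - (1 - Real.exp (-s))| ≤ 3 * s ^ 3 := by
  have h1 := abs_le.1 (abs_log_one_add_sub_le hs hs')
  have h2 := abs_le.1 (abs_one_sub_exp_neg_sub_le hs hs')
  exact abs_le.2 ⟨by linarith [h1.1, h2.2], by linarith [h1.2, h2.1]⟩

theorem one_sub_exp_neg_mem {s : ℝ} (hs : 0 ≤ s) : 1 - Real.exp (-s) ∈ Icc 0 s :=
  ⟨by simpa using hs, by linarith [Real.add_one_le_exp (-s)]⟩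

theorem half_le_log_one_add {s : ℝ} (hs : 0 ≤ s) (hs' : s ≤ 1 / 2) :
    s / 2 ≤ Real.log (1 + s) := by
  have h := Real.one_sub_inv_le_log_of_pos (x := 1 + s) (by linarith)
  refine le_trans ?_ h
  have : 1 - (1 + s)⁻¹ = s / (1 + s) := by field_simp; ring
  rw [this]
  exact div_le_div_of_nonneg_left hs (by linarith) (by linarith)

/-- Replacing both logarithms by 1 - e^{-·} costs O(s⁴) after cross-multiplication; dividing by
log(1+s) ≥ s/2 leaves O(s³). -/
theorem abs_node_mul_sub_le {s x : ℝ} (hs : 0 < s) (hs' : s ≤ 1 / 2) (hx : x ∈ Icc (0 : ℝ) 1) :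
    |Real.log (1 + x * s) / Real.log (1 + s) * (1 - Real.exp (-s)) - (1 - Real.exp (-(x * s)))|
      ≤ 12 * s ^ 3 := by
  have hl := half_le_log_one_add hs.le hs'
  have hxs : 0 ≤ x * s := mul_nonneg hx.1 hs.le
  have hxs' : x * s ≤ s := by nlinarith [hx.2]
  have hl0 : 0 < Real.log (1 + s) := by linarith
  have d1 := abs_log_sub_exp_le hs.le hs'
  have d2 := abs_log_sub_exp_le hxs (hxs'.trans hs')
  have d3 : 3 * (x * s) ^ 3 ≤ 3 * s ^ 3 := by gcongr
  have e1 := one_sub_exp_neg_mem hs.le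
  have e2 := one_sub_exp_neg_mem hxs
  set L := Real.log (1 + s)
  set L' := Real.log (1 + x * s)
  set E := 1 - Real.exp (-s)
  set E' := 1 - Real.exp (-(x * s))
  have e : L' / L * E - E' = ((L' - E') * E - E' * (L - E)) / L := by
    field_simp
    ring
  rw [e, abs_div, abs_of_pos hl0, div_le_iff₀ hl0]
  have a1 : |(L' - E') * E| ≤ 3 * s ^ 3 * s := by
    rw [abs_mul, abs_of_nonneg e1.1]
    exact mul_le_mul (d2.trans d3) e1.2 e1.1 (by positivity)
  have a2 : |E' * (L - E)| ≤ s * (3 * s ^ 3) := by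
    rw [abs_mul, abs_of_nonneg e2.1]
    exact mul_le_mul (e2.2.trans hxs') d1 (abs_nonneg _) hs.le
  calc |(L' - E') * E - E' * (L - E)| ≤ 3 * s ^ 3 * s + s * (3 * s ^ 3) :=
        (abs_sub _ _).trans (add_le_add a1 a2)
    _ = 12 * s ^ 3 * (s / 2) := by ring
    _ ≤ 12 * s ^ 3 * L := by gcongr

/-- The second-order expansion gives x(1-x)s/2; the bound on s lets the cubic remainders consume at
most half of it. -/
theorem mul_le_node_sub {s x : ℝ} (hs : 0 < s) (hx : x ∈ Ioo (0 : ℝ) 1) (hs' : s ≤ (1 - x) / 16) :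
    s * (x * (1 - x) / 4) ≤ Real.log (1 + x * s) / Real.log (1 + s) - x := by
  obtain ⟨hx0, hx1⟩ := hx
  have hs2 : s ≤ 1 / 2 := by linarith
  have hxs : 0 ≤ x * s := by positivity
  have hxs' : x * s ≤ s := by nlinarith
  have hl := half_le_log_one_add hs.le hs2
  have hl0 : 0 < Real.log (1 + s) := by linarith
  have hl1 : Real.log (1 + s) ≤ s := by
    linarith [Real.log_le_sub_one_of_pos (x := 1 + s) (by linarith)]
  have h1 := (abs_le.1 (abs_log_one_add_sub_le hs.le hs2)).2
  have h2 := (abs_le.1 (abs_log_one_add_sub_le hxs (hxs'.trans hs2))).1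
  have h1' := mul_le_mul_of_nonneg_left h1 hx0.le
  have h3 : (x * s) ^ 3 ≤ x * s ^ 3 := by
    have : x ^ 3 ≤ x := by nlinarith [mul_pos hx0 hx0, mul_pos hx0 (sub_pos.2 hx1)]
    rw [mul_pow]
    gcongr
  have h4 : 4 * (x * s ^ 3) ≤ s * (x * (1 - x) / 4) * s := by
    have := mul_le_mul_of_nonneg_left hs' (by positivity : 0 ≤ 4 * (x * s ^ 2))
    nlinarith
  have h5 : s * (x * (1 - x) / 4) * Real.log (1 + s) ≤ s * (x * (1 - x) / 4) * s :=
    mul_le_mul_of_nonneg_left hl1 (by have := sub_pos.2 hx1; positivity)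
  have e : Real.log (1 + x * s) / Real.log (1 + s) - x =
      (Real.log (1 + x * s) - x * Real.log (1 + s)) / Real.log (1 + s) := by
    field_simp
  rw [e, le_div_iff₀ hl0]
  nlinarith

theorem tendsto_step {μ : ℝ} (hμ : 0 < μ) :
    Tendsto (fun n : ℕ => ((1 + μ) * (n : ℝ))⁻¹) atTop (𝓝 0) :=
  (tendsto_natCast_atTop_atTop.const_mul_atTop (by linarith)).inv_tendsto_atTop

/-! ### Rates -/

/-- The error of the Bernstein operators at the nodes tends to zero faster than `1 / n`. -/
def FastAt (μ : ℝ) (g : ℝ → ℝ) (x : ℝ) : Prop :=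
  Tendsto (fun n : ℕ => (n : ℝ) * (bernstein n g (node μ n x) - g x)) atTop (𝓝 0)

theorem FastAt.add {μ x : ℝ} {g h : ℝ → ℝ} (hg : FastAt μ g x) (hh : FastAt μ h x) :
    FastAt μ (fun y => g y + h y) x := by
  have := Tendsto.add hg hh
  rw [add_zero] at this
  refine this.congr fun n => ?_
  rw [bernstein_add]
  ring

theorem FastAt.const_mul {μ x : ℝ} {g : ℝ → ℝ} (hg : FastAt μ g x) (a : ℝ) :
    FastAt μ (fun y => a * g y) x := by
  have := Tendsto.const_mul a hg
  rw [mul_zero] at this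
  refine this.congr fun n => ?_
  rw [bernstein_const_mul]
  ring

theorem fastAt_const (μ x a : ℝ) : FastAt μ (fun _ => a) x := by
  simp [FastAt, bernstein_const]

theorem FastAt.congr {μ x : ℝ} {g h : ℝ → ℝ} (hg : FastAt μ g x) (hgh : EqOn g h (Icc 0 1))
    (hx : x ∈ Icc (0 : ℝ) 1) : FastAt μ h x :=
  Tendsto.congr (fun n => by rw [bernstein_congr hgh, hgh hx]) hg

/-! ### The exponential is approximated fast. -/

theorem abs_pow_sub_pow_le {p q : ℝ} (hp : p ∈ Icc (0 : ℝ) 1) (hq : q ∈ Icc (0 : ℝ) 1) (n : ℕ) :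
    |p ^ n - q ^ n| ≤ n * |p - q| := by
  induction n with
  | zero => simp
  | succ n ih =>
    have e : p ^ (n + 1) - q ^ (n + 1) = p * (p ^ n - q ^ n) + (p - q) * q ^ n := by ring
    rw [e]
    refine (abs_add_le _ _).trans ?_
    rw [abs_mul, abs_mul, abs_of_nonneg hp.1, abs_of_nonneg (pow_nonneg hq.1 n)]
    have h1 : p * |p ^ n - q ^ n| ≤ |p ^ n - q ^ n| :=
      mul_le_of_le_one_left (abs_nonneg _) hp.2
    have h2 : |p - q| * q ^ n ≤ |p - q| :=
      mul_le_of_le_one_right (abs_nonneg _) (pow_le_one₀ hq.1 hq.2)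
    push_cast
    linarith

theorem fastAt_exp {μ : ℝ} (hμ : 0 < μ) {x : ℝ} (hx : x ∈ Icc (0 : ℝ) 1) :
    FastAt μ (fun y => Real.exp (-(1 + μ)⁻¹ * y)) x := by
  have hlim : Tendsto (fun n : ℕ => 12 / (1 + μ) ^ 2 * ((1 + μ) * (n : ℝ))⁻¹) atTop (𝓝 0) := by
    simpa using (tendsto_step hμ).const_mul (12 / (1 + μ) ^ 2)
  refine squeeze_zero_norm' ?_ hlim
  filter_upwards [eventually_ne_atTop 0,
    (tendsto_step hμ).eventually (eventually_le_nhds (by norm_num : (0 : ℝ) < 1 / 2))] with n hn hs'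
  have hn' : (0 : ℝ) < n := Nat.cast_pos.2 (Nat.pos_of_ne_zero hn)
  have hs : 0 < ((1 + μ) * (n : ℝ))⁻¹ := by positivity
  have ha := node_mem hμ hn hx
  have hb : -(1 + μ)⁻¹ / n = -((1 + μ) * (n : ℝ))⁻¹ := by
    field_simp
  have hq : Real.exp (-(1 + μ)⁻¹ * x) = Real.exp (-(x * ((1 + μ) * (n : ℝ))⁻¹)) ^ n := by
    rw [← Real.exp_nat_mul]
    congr 1
    field_simp
  have key := abs_node_mul_sub_le hs hs' hx
  rw [← node_eq hμ hn hx.1] at key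
  rw [bernstein_exp hn, hb, hq, Real.norm_eq_abs, abs_mul, abs_of_pos hn']
  set s := ((1 + μ) * (n : ℝ))⁻¹ with hsdef
  have e1 := one_sub_exp_neg_mem hs.le
  have e0 := Real.exp_pos (-s)
  have hp : 1 - node μ n x * (1 - Real.exp (-s)) ∈ Icc (0 : ℝ) 1 := by
    constructor
    · nlinarith [ha.1, ha.2, e1.1]
    · linarith [mul_nonneg ha.1 e1.1]
  have hq' : Real.exp (-(x * s)) ∈ Icc (0 : ℝ) 1 :=
    ⟨(Real.exp_pos _).le, Real.exp_le_one_iff.2 (by linarith [mul_nonneg hx.1 hs.le])⟩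
  have hpq : |1 - node μ n x * (1 - Real.exp (-s)) - Real.exp (-(x * s))| ≤ 12 * s ^ 3 := by
    rw [← abs_neg]
    refine le_trans (le_of_eq ?_) key
    congr 1
    ring
  -- One factor n comes from the rate, the other from the n-th power; since ns = 1/(1+μ), the bound
  -- n²s³ is still O(s).
  calc (n : ℝ) * |(1 - node μ n x * (1 - Real.exp (-s))) ^ n - Real.exp (-(x * s)) ^ n|
      ≤ n * (n * (12 * s ^ 3)) := by
        gcongr
        exact (abs_pow_sub_pow_le hp hq' n).trans (by gcongr)
    _ = 12 / (1 + μ) ^ 2 * s := by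
        rw [hsdef]
        field_simp

/-! ### Maximum principle and uniqueness. -/

theorem nonpos_of_fastAt {μ : ℝ} (hμ : 0 < μ) {u : ℝ → ℝ} (hu : ContinuousOn u (Icc 0 1))
    (h0 : u 0 = 0) (h1 : u 1 = 0) (hfast : ∀ x ∈ Ioo (0 : ℝ) 1, FastAt μ u x) :
    ∀ x ∈ Icc (0 : ℝ) 1, u x ≤ 0 := by
  intro y hy
  by_contra! hpos
  -- Small enough that u + εt, equal to 0 at 0 and ε at 1, takes a larger value at y, so its maximum
  -- is interior.
  set ε := u y / 2 with hε
  have hε0 : 0 < ε := by positivity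
  obtain ⟨z, hz, hmax⟩ := isCompact_Icc.exists_isMaxOn (nonempty_of_mem hy)
    (hu.add (continuousOn_const.mul continuousOn_id : ContinuousOn (fun t : ℝ => ε * t) (Icc 0 1)))
  have hmax' : ∀ t ∈ Icc (0 : ℝ) 1, u t + ε * t ≤ u z + ε * z := fun t ht => hmax ht
  have hyz := hmax' y hy
  have hεy : 0 ≤ ε * y := mul_nonneg hε0.le hy.1
  have hz0 : z ≠ 0 := by
    rintro rfl
    linarith
  have hz1 : z ≠ 1 := by
    rintro rfl
    linarith
  have hzI : z ∈ Ioo (0 : ℝ) 1 := ⟨lt_of_le_of_ne hz.1 hz0.symm, lt_of_le_of_ne hz.2 hz1⟩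
  have hz2 : 0 < 1 - z := sub_pos.2 hzI.2
  have hz3 := hzI.1
  -- Lower bound for nε(a_n(z) - z). Positivity of the operator at the maximum z then makes n times
  -- the error of u at most -δ, contradicting the rate.
  set δ := ε * ((1 + μ)⁻¹ * (z * (1 - z) / 4)) with hδ
  have hδ0 : 0 < δ := by positivity
  obtain ⟨n, hn, hs', hlt⟩ := ((eventually_ne_atTop 0).and
    (((tendsto_step hμ).eventually (eventually_le_nhds (by positivity : 0 < (1 - z) / 16))).and
      ((hfast z hzI).eventually (eventually_gt_nhds (by linarith : -δ < 0))))).exists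
  have hn' : (0 : ℝ) < n := Nat.cast_pos.2 (Nat.pos_of_ne_zero hn)
  have hs : 0 < ((1 + μ) * (n : ℝ))⁻¹ := by positivity
  have hle := bernstein_le (n := n) (node_mem hμ hn hz) hmax'
  rw [bernstein_add, bernstein_const_mul, bernstein_id hn] at hle
  have hnode := mul_le_node_sub hs hzI hs'
  rw [← node_eq hμ hn hz.1] at hnode
  have hnδ : δ ≤ n * (ε * (node μ n z - z)) := by
    calc δ = n * (ε * (((1 + μ) * (n : ℝ))⁻¹ * (z * (1 - z) / 4))) := by
          rw [hδ]
          field_simp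
      _ ≤ _ := by gcongr
  have := mul_le_mul_of_nonneg_left hle hn'.le
  nlinarith

theorem exists_eq_of_fastAt {μ : ℝ} (hμ : 0 < μ) {g : ℝ → ℝ} (hg : ContinuousOn g (Icc 0 1))
    (hfast : ∀ x ∈ Ioo (0 : ℝ) 1, FastAt μ g x) :
    ∃ A B : ℝ, ∀ x ∈ Icc (0 : ℝ) 1, g x = A + B * Real.exp (-(1 + μ)⁻¹ * x) := by
  have hE : Real.exp (-(1 + μ)⁻¹) - 1 ≠ 0 := by
    have : Real.exp (-(1 + μ)⁻¹) < 1 := Real.exp_lt_one_iff.2 (neg_lt_zero.2 (by positivity))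
    linarith
  -- Chosen so that w below vanishes at both endpoints.
  set B := (g 1 - g 0) / (Real.exp (-(1 + μ)⁻¹) - 1) with hB
  have hB' : B * (Real.exp (-(1 + μ)⁻¹) - 1) = g 1 - g 0 := div_mul_cancel₀ _ hE
  set w : ℝ → ℝ := fun x => g x + (-(g 0 - B) + -B * Real.exp (-(1 + μ)⁻¹ * x)) with hw
  have hwc : ContinuousOn w (Icc 0 1) := hg.add (by fun_prop)
  have hwf : ∀ x ∈ Ioo (0 : ℝ) 1, FastAt μ w x := fun x hx => (hfast x hx).add
    ((fastAt_const μ x _).add ((fastAt_exp hμ (Ioo_subset_Icc_self hx)).const_mul _))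
  have w0 : w 0 = 0 := by
    simp only [hw, mul_zero, Real.exp_zero]
    ring
  have w1 : w 1 = 0 := by
    simp only [hw, mul_one]
    linarith
  have hle := nonpos_of_fastAt hμ hwc w0 w1 hwf
  have hge := nonpos_of_fastAt (u := fun x => -1 * w x) hμ (continuousOn_const.mul hwc)
    (by simp [w0]) (by simp [w1]) fun x hx => (hwf x hx).const_mul _
  refine ⟨g 0 - B, B, fun x hx => ?_⟩
  have h1 := hle x hx
  have h2 := hge x hx
  simp only [hw] at h1 h2
  linarith

theorem isLittleO_iff_fastAt {μ : ℝ} (hμ : 0 < μ) (f : ℝ → ℝ) {x : ℝ} (hx : 0 ≤ x) :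
    (fun n : ℕ => |logOp μ n f x - f x|) =o[atTop] (fun n : ℕ => ((n : ℝ))⁻¹) ↔
      FastAt μ (quot μ f) x := by
  have hl := lnMu_pos hμ hx
  have e : ∀ n : ℕ, logOp μ n f x - f x =
      lnMu μ x * (bernstein n (quot μ f) (node μ n x) - quot μ f x) := by
    intro n
    rw [logOp_eq, quot]
    field_simp
  rw [isLittleO_abs_left, isLittleO_iff_tendsto' (by
    filter_upwards [eventually_ne_atTop 0] with n hn h
    simp [hn] at h)]
  constructor
  · intro h
    have := h.const_mul (lnMu μ x)⁻¹
    rw [mul_zero] at this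
    refine Tendsto.congr (fun n => ?_) this
    rw [e, div_inv_eq_mul]
    field_simp
  · intro h
    have := Tendsto.const_mul (lnMu μ x) h
    rw [mul_zero] at this
    refine this.congr fun n => ?_
    rw [e, div_inv_eq_mul]
    ring

/-! ### The differential equation -/

theorem continuousOn_quot {μ : ℝ} (hμ : 0 < μ) {f : ℝ → ℝ} (hf : ContinuousOn f (Icc 0 1)) :
    ContinuousOn (quot μ f) (Icc 0 1) := by
  refine hf.div ?_ fun x hx => (lnMu_pos hμ hx.1).ne'
  exact ContinuousOn.log (by fun_prop) fun x hx => by linarith [hx.1]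

theorem contDiffOn_lnMu {μ : ℝ} (hμ : 0 < μ) : ContDiffOn ℝ 2 (lnMu μ) (Ioo 0 1) :=
  ContDiffOn.log (by fun_prop) fun x hx => by linarith [hx.1]

theorem hasDerivAt_exp_mul (b x : ℝ) :
    HasDerivAt (fun y => Real.exp (b * y)) (b * Real.exp (b * x)) x := by
  simpa [mul_comm] using ((hasDerivAt_id x).const_mul b).exp

theorem isClassicalSolution_of_eq {μ : ℝ} (hμ : 0 < μ) {f : ℝ → ℝ} {A B : ℝ}
    (h : ∀ x ∈ Icc (0 : ℝ) 1, quot μ f x = A + B * Real.exp (-(1 + μ)⁻¹ * x)) :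
    IsClassicalSolution μ f := by
  have hI : ∀ x ∈ Ioo (0 : ℝ) 1, quot μ f x = A + B * Real.exp (-(1 + μ)⁻¹ * x) :=
    fun x hx => h x (Ioo_subset_Icc_self hx)
  have d1 : ∀ x ∈ Ioo (0 : ℝ) 1,
      deriv (quot μ f) x = B * (-(1 + μ)⁻¹ * Real.exp (-(1 + μ)⁻¹ * x)) := by
    intro x hx
    rw [(eventuallyEq_of_mem (isOpen_Ioo.mem_nhds hx) hI).deriv_eq]
    exact (((hasDerivAt_exp_mul _ x).const_mul B).const_add A).deriv
  refine ⟨?_, fun x hx => ?_⟩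
  · have : ContDiffOn ℝ 2 (fun x => (A + B * Real.exp (-(1 + μ)⁻¹ * x)) * lnMu μ x) (Ioo 0 1) :=
      ContDiffOn.mul (by fun_prop) (contDiffOn_lnMu hμ)
    refine this.congr fun x hx => ?_
    rw [← hI x hx, quot, div_mul_cancel₀ _ (lnMu_pos hμ hx.1.le).ne']
  · rw [(eventuallyEq_of_mem (isOpen_Ioo.mem_nhds hx) d1).deriv_eq, d1 x hx,
      (((hasDerivAt_exp_mul _ x).const_mul (-(1 + μ)⁻¹)).const_mul B).deriv]
    field_simp
    ring

theorem exists_eqOn_const_of_hasDerivAt_zero {F : ℝ → ℝ}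
    (h : ∀ x ∈ Ioo (0 : ℝ) 1, HasDerivAt F 0 x) : ∃ K, ∀ x ∈ Ioo (0 : ℝ) 1, F x = K :=
  isOpen_Ioo.exists_is_const_of_deriv_eq_zero isPreconnected_Ioo
    (fun x hx => (h x hx).differentiableAt.differentiableWithinAt) fun x hx => (h x hx).deriv

theorem IsClassicalSolution.exists_eq {μ : ℝ} (hμ : 0 < μ) {f : ℝ → ℝ}
    (hf : ContinuousOn f (Icc 0 1)) (h : IsClassicalSolution μ f) :
    ∃ A B : ℝ, ∀ x ∈ Icc (0 : ℝ) 1, quot μ f x = A + B * Real.exp (-(1 + μ)⁻¹ * x) := by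
  obtain ⟨hd, hode⟩ := h
  have hq : ContDiffOn ℝ 2 (quot μ f) (Ioo 0 1) :=
    hd.div (contDiffOn_lnMu hμ) fun x hx => (lnMu_pos hμ hx.1.le).ne'
  have hq1 : ∀ x ∈ Ioo (0 : ℝ) 1, HasDerivAt (quot μ f) (deriv (quot μ f) x) x := fun x hx =>
    ((hq.differentiableOn (by norm_num)).differentiableAt (isOpen_Ioo.mem_nhds hx)).hasDerivAt
  have hq2 : ∀ x ∈ Ioo (0 : ℝ) 1,
      HasDerivAt (deriv (quot μ f)) (deriv (deriv (quot μ f)) x) x := fun x hx =>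
    (((hq.deriv_of_isOpen (m := 1) isOpen_Ioo (by norm_num)).differentiableOn
      (by norm_num)).differentiableAt (isOpen_Ioo.mem_nhds hx)).hasDerivAt
  -- The equation says that q + (1+μ)q' is constant; an integrating factor then solves this
  -- first-order equation.
  obtain ⟨A, hA⟩ := exists_eqOn_const_of_hasDerivAt_zero
    (F := fun x => quot μ f x + (1 + μ) * deriv (quot μ f) x) fun x hx => by
      have := (hq1 x hx).add ((hq2 x hx).const_mul (1 + μ))
      rwa [hode x hx] at this
  obtain ⟨B, hB⟩ := exists_eqOn_const_of_hasDerivAt_zero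
    (F := fun x => (quot μ f x - A) * Real.exp ((1 + μ)⁻¹ * x)) fun x hx => by
      have := ((hq1 x hx).sub_const A).mul (hasDerivAt_exp_mul (1 + μ)⁻¹ x)
      refine this.congr_deriv ?_
      have hAx := hA x hx
      have : quot μ f x - A = -((1 + μ) * deriv (quot μ f) x) := by linarith
      rw [this]
      field_simp
      ring
  refine ⟨A, B, ?_⟩
  have hI : EqOn (quot μ f) (fun x => A + B * Real.exp (-(1 + μ)⁻¹ * x)) (Ioo 0 1) := by
    intro x hx
    have := hB x hx
    simp only [← this, neg_mul, Real.exp_neg]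
    have := (Real.exp_pos ((1 + μ)⁻¹ * x)).ne'
    field_simp
    ring
  -- Continuity of f on the closed interval carries the formula to the endpoints.
  exact hI.of_subset_closure (continuousOn_quot hμ hf) (by fun_prop) Ioo_subset_Icc_self
    (by rw [closure_Ioo zero_ne_one])

theorem eq_iff_quot_eq {μ : ℝ} (hμ : 0 < μ) (f : ℝ → ℝ) (A B : ℝ) {x : ℝ} (hx : 0 ≤ x) :
    f x = A * lnMu μ x + B * lnMu μ x * Real.exp (-x / (1 + μ)) ↔
      quot μ f x = A + B * Real.exp (-(1 + μ)⁻¹ * x) := by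
  have e : -x / (1 + μ) = -(1 + μ)⁻¹ * x := by ring
  rw [quot, div_eq_iff (lnMu_pos hμ hx).ne', e]
  constructor <;> intro h <;> rw [h] <;> ring

end LogBernstein

theorem mainTheorem2 (μ : ℝ) (hμ : 0 < μ) (f : ℝ → ℝ) (hf : ContinuousOn f (Set.Icc 0 1)) :
    ((∀ x ∈ Set.Ioo (0 : ℝ) 1,
        (fun n : ℕ => |LogBernstein.logOp μ n f x - f x|) =o[Filter.atTop]
          (fun n : ℕ => ((n : ℝ))⁻¹)) ↔
      LogBernstein.IsClassicalSolution μ f) ∧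
    (LogBernstein.IsClassicalSolution μ f ↔
      ∃ A B : ℝ, ∀ x ∈ Set.Icc (0 : ℝ) 1,
        f x = A * LogBernstein.lnMu μ x +
          B * LogBernstein.lnMu μ x * Real.exp (-x / (1 + μ))) := by
  have hsol : LogBernstein.IsClassicalSolution μ f ↔ ∃ A B : ℝ, ∀ x ∈ Set.Icc (0 : ℝ) 1,
      LogBernstein.quot μ f x = A + B * Real.exp (-(1 + μ)⁻¹ * x) :=
    ⟨fun h => h.exists_eq hμ hf,
      fun ⟨_, _, h⟩ => LogBernstein.isClassicalSolution_of_eq hμ h⟩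
  refine ⟨⟨fun h => hsol.2 ?_, fun h x hx => ?_⟩, hsol.trans ?_⟩
  · exact LogBernstein.exists_eq_of_fastAt hμ (LogBernstein.continuousOn_quot hμ hf)
      fun x hx => (LogBernstein.isLittleO_iff_fastAt hμ f hx.1.le).1 (h x hx)
  · obtain ⟨A, B, hAB⟩ := hsol.1 h
    have hx' := Set.Ioo_subset_Icc_self hx
    exact (LogBernstein.isLittleO_iff_fastAt hμ f hx.1.le).2
      (((LogBernstein.fastAt_const μ x A).add
        ((LogBernstein.fastAt_exp hμ hx').const_mul B)).congr (fun y hy => (hAB y hy).symm) hx')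
  · exact exists_congr fun A => exists_congr fun B => forall₂_congr fun x hx =>
      (LogBernstein.eq_iff_quot_eq hμ f A B hx.1).symm
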